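/- Fix an algebraic language without constant symbols and let $Fm$ be its set of formulas over a countably infinite set of variables. For $\varphi\in Fm$ let $Var(\varphi)$ be the set of variables occurring in $\varphi$, and put $Var(\Gamma)=\bigcup_{\gamma\in\Gamma}Var(\gamma)$. A logic is a substitution-invariant consequence relation $\vdash\ \subseteq\mathcal P(Fm)\times Fm$. A set $S\subseteq Fm$ is an antitheorem of $\vdash$ if $\sigma[S]\vdash\varphi$ for every substitution $\sigma$ and every formula $\varphi$. The containment companion $\vdash^r$ of $\vdash$ is the logic defined by: $\Gamma\vdash^r\varphi$ iff either $\Gamma\vdash\varphi$ and $Var(\varphi)\subseteq Var(\Gamma)$, or $\Gamma$ includes a nonempty antitheorem of $\vdash$. The partition identities for a binary formula $x\ast y$ are (P1) $x\ast x\approx x$; (P2) $x\ast(y\ast z)\approx(x\ast y)\ast z$; (P3) $x\ast(y\ast z)\approx x\ast(z\ast y)$; (P4) $g(x_1,\dots,x_n)\ast y\approx g(x_1\ast y,\dots,x_n\ast y)$; (P5) $y\ast g(x_1,\dots,x_n)\approx(\cdots((y\ast x_1)\ast x_2)\ast\cdots)\ast x_n$, with $g$ ranging over the basic operations, of arity $n\ge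 1$. A formula $x\ast y$ in which exactly the two variables $x,y$ occur is an r-partition function for $\vdash$ if $x,y\vdash x\ast y$, $x\ast y\vdash x$, and, for every partition identity $\delta\approx\varepsilon$ and every formula $\chi(v,\vec z)$, both $\chi(\delta,\vec z)\vdash\chi(\varepsilon,\vec z)$ and $\chi(\varepsilon,\vec z)\vdash\chi(\delta,\vec z)$. A Hilbert-style calculus is a (possibly infinite) set of rules $P\rhd\psi$ with $P\subseteq Fm$ and $\psi\in Fm$; axioms are the rules with $P=\emptyset$. It has finite rules if each $P$ is finite. A formula $\varphi$ is derivable from $\Gamma$ if it is obtained from elements of $\Gamma$ by applying substitution instances of the rules, and the calculus is complete for a logic if derivability from arbitrary sets of premises coincides with that logic. Theorem. Let $\vdash$ be a finitary logic with an r-partition function $\ast$ and an antitheorem $\Sigma(x)$ (a set of formulas with $Var(\Sigma)=\{x\}$), and let $\mathcal H$ be a Hilbert-style calculus with finite rules that is complete for $\vdash$. Let $\mathcal H^r$ be the Hilbert-style calculus with the following rules: (H0) $y\ast\varphi\rhd\varphi$, for every axiom $\rhd\varphi$ of $\mathcal H$ and every variable $y$; (H1) $y,z\rhd y\ast z$,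 for all variables $y,z$; (H2) $y\ast z\rhd y$, for all variables $y,z$; (H3) $\{\gamma_1,\dots,\gamma_n\}\smallsetminus\{\gamma_i\},\ \gamma_i\ast\psi\rhd\psi$, for every rule $\gamma_1,\dots,\gamma_n\rhd\psi$ of $\mathcal H$ with $n\ge 1$ and every $i\in\{1,\dots,n\}$; (H4) $\Sigma(x)\rhd\alpha$, for every formula $\alpha$; (H5) $\chi(\delta,\vec z)\rhd\chi(\varepsilon,\vec z)$ and $\chi(\varepsilon,\vec z)\rhd\chi(\delta,\vec z)$, for every partition identity $\delta\approx\varepsilon$ and every formula $\chi(v,\vec z)$. Then $\mathcal H^r$ is complete for $\vdash^r$. -/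

import Mathlib

universe u v

namespace ContainmentLogic

open FirstOrder.Language

/-- Formulas over the countably infinite set `ℕ` of variables, in the algebraic language whose
`n`-ary connectives are `L.Functions n` (relation symbols of `L` play no role). -/
abbrev Fm (L : FirstOrder.Language.{u, v}) : Type u := L.Term ℕ

/-- The set of variables really occurring in a formula. -/
def varsOf {L : FirstOrder.Language.{u, v}} (φ : Fm L) : Set ℕ := ↑φ.varFinset

/-- The set of variables really occurring in a set of formulas. -/
def varsOfSet {L : FirstOrder.Language.{u, v}} (Γ : Set (Fm L)) : Set ℕ := ⋃ γ ∈ Γ, varsOf γ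

/-- A substitution, as an endomorphism of the formula algebra, is determined by its values on the
variables; this is its action on a set of formulas. -/
def substSet {L : FirstOrder.Language.{u, v}} (s : ℕ → Fm L) (Γ : Set (Fm L)) : Set (Fm L) :=
  (fun γ => γ.subst s) '' Γ

/-- A logic: a substitution invariant consequence relation between sets of formulas and
formulas. -/
structure Logic (L : FirstOrder.Language.{u, v}) where
  Entails : Set (Fm L) → Fm L → Prop
  refl : ∀ {Γ : Set (Fm L)} {φ : Fm L}, φ ∈ Γ → Entails Γ φ
  mono : ∀ {Γ Δ : Set (Fm L)} {φ : Fm L}, Γ ⊆ Δ → Entails Γ φ → Entails Δ φ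
  cut : ∀ {Γ Δ : Set (Fm L)} {φ : Fm L}, (∀ δ ∈ Δ, Entails Γ δ) → Entails Δ φ → Entails Γ φ
  structural : ∀ {Γ : Set (Fm L)} {φ : Fm L} (s : ℕ → Fm L),
    Entails Γ φ → Entails (substSet s Γ) (φ.subst s)

/-- Finitary logics. -/
def Logic.Finitary {L : FirstOrder.Language.{u, v}} (l : Logic L) : Prop :=
  ∀ (Γ : Set (Fm L)) (φ : Fm L),
    l.Entails Γ φ ↔ ∃ Δ : Set (Fm L), Δ ⊆ Γ ∧ Δ.Finite ∧ l.Entails Δ φ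

/-- Antitheorems: sets of formulas all of whose substitution instances entail everything. -/
def Logic.IsAntitheorem {L : FirstOrder.Language.{u, v}} (l : Logic L) (S : Set (Fm L)) : Prop :=
  ∀ (s : ℕ → Fm L) (φ : Fm L), l.Entails (substSet s S) φ

/-! ### Containment companion -/

theorem mem_varsOf_subst {L : FirstOrder.Language.{u, v}} (s : ℕ → Fm L) (φ : Fm L) (n : ℕ) :
    n ∈ varsOf (φ.subst s) ↔ ∃ m ∈ varsOf φ, n ∈ varsOf (s m) := by
  induction φ with
  | var m => simp [varsOf, Term.subst, Term.varFinset]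
  | func f ts ih =>
    simp only [varsOf, Term.subst, Term.varFinset, Finset.coe_biUnion, Finset.coe_univ,
      Set.mem_univ, Set.iUnion_true, Set.mem_iUnion] at ih ⊢
    constructor
    · rintro ⟨i, hi⟩
      obtain ⟨m, hm, hn⟩ := (ih i).1 hi
      exact ⟨m, ⟨i, hm⟩, hn⟩
    · rintro ⟨m, ⟨i, hm⟩, hn⟩
      exact ⟨i, (ih i).2 ⟨m, hm, hn⟩⟩

theorem varsOf_nonempty {L : FirstOrder.Language.{u, v}} [IsEmpty L.Constants] (φ : Fm L) :
    (varsOf φ).Nonempty := by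
  induction φ with
  | var m => exact ⟨m, by simp [varsOf, Term.varFinset]⟩
  | @func n f ts ih =>
    cases n with
    | zero => exact isEmptyElim (α := L.Constants) f
    | succ n =>
      obtain ⟨m, hm⟩ := ih 0
      refine ⟨m, ?_⟩
      simp only [varsOf, Term.varFinset, Finset.coe_biUnion, Finset.coe_univ, Set.mem_univ,
        Set.iUnion_true, Set.mem_iUnion] at hm ⊢
      exact ⟨0, hm⟩

theorem mem_varsOfSet {L : FirstOrder.Language.{u, v}} (Γ : Set (Fm L)) (n : ℕ) :
    n ∈ varsOfSet Γ ↔ ∃ γ ∈ Γ, n ∈ varsOf γ := by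
  simp [varsOfSet]

theorem substSet_substSet {L : FirstOrder.Language.{u, v}} (s t : ℕ → Fm L) (Γ : Set (Fm L)) :
    substSet t (substSet s Γ) = substSet (fun n => (s n).subst t) Γ := by
  have h : ∀ φ : Fm L, (φ.subst s).subst t = φ.subst (fun n => (s n).subst t) := by
    intro φ
    induction φ with
    | var m => rfl
    | func f ts ih => simp only [Term.subst, ih]
  simp only [substSet, Set.image_image, h]

/-- `Γ ⊢ʳ φ` iff `Γ ⊢ φ` with all variables of `φ` occurring in `Γ`, or `Γ` includes an
antitheorem of `⊢` (one in which some variable really occurs, that is, a nonempty one). -/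
def Logic.ContainmentEntails {L : FirstOrder.Language.{u, v}} (l : Logic L) (Γ : Set (Fm L)) (φ : Fm L) :
    Prop :=
  (l.Entails Γ φ ∧ varsOf φ ⊆ varsOfSet Γ) ∨
    ∃ S : Set (Fm L), S.Nonempty ∧ l.IsAntitheorem S ∧ S ⊆ Γ

/-- The containment companion `⊢ʳ` of a logic `⊢`, in a language without constants. -/
def Logic.containment {L : FirstOrder.Language.{u, v}} [IsEmpty L.Constants] (l : Logic L) : Logic L where
  Entails := l.ContainmentEntails
  refl := by
    intro Γ φ h
    exact Or.inl ⟨l.refl h, fun n hn => (mem_varsOfSet Γ n).2 ⟨φ, h, hn⟩⟩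
  mono := by
    rintro Γ Δ φ h (⟨h1, h2⟩ | ⟨S, hne, hS, hSΓ⟩)
    · refine Or.inl ⟨l.mono h h1, fun n hn => ?_⟩
      obtain ⟨γ, hγ, hnγ⟩ := (mem_varsOfSet Γ n).1 (h2 hn)
      exact (mem_varsOfSet Δ n).2 ⟨γ, h hγ, hnγ⟩
    · exact Or.inr ⟨S, hne, hS, hSΓ.trans h⟩
  cut := by
    intro Γ Δ φ hΔ hφ
    by_cases hΓ : ∃ S : Set (Fm L), S.Nonempty ∧ l.IsAntitheorem S ∧ S ⊆ Γ
    · exact Or.inr hΓ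
    have hΔ2 : ∀ δ ∈ Δ, l.Entails Γ δ ∧ varsOf δ ⊆ varsOfSet Γ := fun δ hδ =>
      (hΔ δ hδ).resolve_right hΓ
    rcases hφ with ⟨h1, h2⟩ | ⟨S, ⟨a, ha⟩, hS, hSΔ⟩
    · refine Or.inl ⟨l.cut (fun δ hδ => (hΔ2 δ hδ).1) h1, fun n hn => ?_⟩
      obtain ⟨δ, hδ, hnδ⟩ := (mem_varsOfSet Δ n).1 (h2 hn)
      exact (hΔ2 δ hδ).2 hnδ
    · refine Or.inr ⟨Γ, ?_, ?_, subset_rfl⟩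
      · obtain ⟨n, hn⟩ := varsOf_nonempty a
        obtain ⟨γ, hγ, -⟩ := (mem_varsOfSet Γ n).1 ((hΔ2 a (hSΔ ha)).2 hn)
        exact ⟨γ, hγ⟩
      · intro s ψ
        refine l.cut ?_ (hS s ψ)
        rintro _ ⟨b, hb, rfl⟩
        exact l.structural s (hΔ2 b (hSΔ hb)).1
  structural := by
    rintro Γ φ s (⟨h1, h2⟩ | ⟨S, ⟨a, ha⟩, hS, hSΓ⟩)
    · refine Or.inl ⟨l.structural s h1, fun n hn => ?_⟩
      obtain ⟨m, hm, hnm⟩ := (mem_varsOf_subst s φ n).1 hn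
      obtain ⟨γ, hγ, hmγ⟩ := (mem_varsOfSet Γ m).1 (h2 hm)
      exact (mem_varsOfSet _ n).2
        ⟨γ.subst s, ⟨γ, hγ, rfl⟩, (mem_varsOf_subst s γ n).2 ⟨m, hmγ, hnm⟩⟩
    · refine Or.inr ⟨substSet s S, ⟨_, a, ha, rfl⟩, fun t ψ => ?_, Set.image_mono hSΓ⟩
      rw [substSet_substSet]
      exact hS _ ψ

/-! ### r-partition functions -/

/-- `α ∗ β`, the result of replacing the two variables of the binary formula `star` by
`α` and `β`. -/
def app {L : FirstOrder.Language.{u, v}} (star : L.Term (Fin 2)) (α β : Fm L) : Fm L :=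
  star.subst ![α, β]

/-- `replaceVar χ v δ` is `χ(δ, z⃗)`: the variable `v` of `χ(v, z⃗)` is replaced by `δ`, the other
variables are left unchanged. -/
def replaceVar {L : FirstOrder.Language.{u, v}} (χ : Fm L) (v : ℕ) (δ : Fm L) : Fm L :=
  χ.subst (Function.update Term.var v δ)

/-- The identities `δ ≈ ε` defining partition functions, for the binary term `star`. -/
inductive PartitionIdentity {L : FirstOrder.Language.{u, v}} (star : L.Term (Fin 2)) : Fm L → Fm L → Prop
  /-- `a ∗ a ≈ a` -/
  | p1 (a : ℕ) : PartitionIdentity star (app star (.var a) (.var a)) (.var a)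
  /-- `a ∗ (b ∗ c) ≈ (a ∗ b) ∗ c` -/
  | p2 (a b c : ℕ) : PartitionIdentity star
      (app star (.var a) (app star (.var b) (.var c)))
      (app star (app star (.var a) (.var b)) (.var c))
  /-- `a ∗ (b ∗ c) ≈ a ∗ (c ∗ b)` -/
  | p3 (a b c : ℕ) : PartitionIdentity star
      (app star (.var a) (app star (.var b) (.var c)))
      (app star (.var a) (app star (.var c) (.var b)))
  /-- `g(a₁, …, aₙ) ∗ b ≈ g(a₁ ∗ b, …, aₙ ∗ b)`, for `g` of arity at least one -/
  | p4 {n : ℕ} (g : L.Functions (n + 1)) (a : Fin (n + 1) → ℕ) (b : ℕ) : PartitionIdentity star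
      (app star (.func g fun i => .var (a i)) (.var b))
      (.func g fun i => app star (.var (a i)) (.var b))
  /-- `b ∗ g(a₁, …, aₙ) ≈ (…((b ∗ a₁) ∗ a₂) ∗ …) ∗ aₙ`, for `g` of arity at least one -/
  | p5 {n : ℕ} (g : L.Functions (n + 1)) (a : Fin (n + 1) → ℕ) (b : ℕ) : PartitionIdentity star
      (app star (.var b) (.func g fun i => .var (a i)))
      ((List.ofFn fun i => (.var (a i) : Fm L)).foldl (app star) (.var b))

/-- `star` is an r-partition function for the logic `l`. -/
structure Logic.IsRPartitionFunction {L : FirstOrder.Language.{u, v}} (l : Logic L) (star : L.Term (Fin 2)) :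
    Prop where
  /-- both variables really occur -/
  occur : ∀ i : Fin 2, i ∈ star.varFinset
  entails_app : ∀ x y : ℕ, l.Entails {.var x, .var y} (app star (.var x) (.var y))
  app_entails : ∀ x y : ℕ, l.Entails {app star (.var x) (.var y)} (.var x)
  interderivable : ∀ (δ ε : Fm L), PartitionIdentity star δ ε → ∀ (φ : Fm L) (v : ℕ),
    l.Entails {replaceVar φ v ε} (replaceVar φ v δ) ∧
      l.Entails {replaceVar φ v δ} (replaceVar φ v ε)

/-! ### Hilbert-style calculi -/

/-- A Hilbert-style rule `premises ▷ conclusion`. -/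
structure HilbertRule (L : FirstOrder.Language.{u, v}) where
  premises : Set (Fm L)
  conclusion : Fm L

/-- A Hilbert-style calculus is a set of rules. -/
abbrev HilbertCalculus (L : FirstOrder.Language.{u, v}) := Set (HilbertRule L)

/-- Each rule has finitely many premises. -/
def HilbertCalculus.HasFiniteRules {L : FirstOrder.Language.{u, v}} (H : HilbertCalculus L) : Prop :=
  ∀ r ∈ H, r.premises.Finite

/-- Derivability from the premises `Γ`, by means of substitution instances of the rules. -/
inductive HilbertCalculus.Derives {L : FirstOrder.Language.{u, v}} (H : HilbertCalculus L)
    (Γ : Set (Fm L)) : Fm L → Prop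
  | hyp {φ : Fm L} : φ ∈ Γ → HilbertCalculus.Derives H Γ φ
  | rule {r : HilbertRule L} (hr : r ∈ H) (s : ℕ → Fm L) :
      (∀ γ ∈ r.premises, HilbertCalculus.Derives H Γ (γ.subst s)) →
      HilbertCalculus.Derives H Γ (r.conclusion.subst s)

/-- A calculus is complete for a logic when it determines exactly that logic. -/
def HilbertCalculus.IsCompleteFor {L : FirstOrder.Language.{u, v}} (H : HilbertCalculus L) (l : Logic L) :
    Prop :=
  ∀ (Γ : Set (Fm L)) (φ : Fm L), H.Derives Γ φ ↔ l.Entails Γ φ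

/-- The rules of the calculus `Hʳ` built from `H`, `∗` and the antitheorem `S`. -/
inductive HilbertCalculus.CompanionRule {L : FirstOrder.Language.{u, v}} (H : HilbertCalculus L)
    (star : L.Term (Fin 2)) (S : Set (Fm L)) : HilbertRule L → Prop
  /-- `x ∗ φ ▷ φ`, for `▷ φ` in `H` -/
  | h0 (φ : Fm L) (hφ : (⟨∅, φ⟩ : HilbertRule L) ∈ H) (x : ℕ) :
      HilbertCalculus.CompanionRule H star S ⟨{app star (.var x) φ}, φ⟩
  /-- `x, y ▷ x ∗ y` -/
  | h1 (x y : ℕ) : HilbertCalculus.CompanionRule H star S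
      ⟨{.var x, .var y}, app star (.var x) (.var y)⟩
  /-- `x ∗ y ▷ x` -/
  | h2 (x y : ℕ) : HilbertCalculus.CompanionRule H star S
      ⟨{app star (.var x) (.var y)}, .var x⟩
  /-- `{γ₁, …, γₙ} \ {γᵢ}, γᵢ ∗ ψ ▷ ψ`, for `γ₁, …, γₙ ▷ ψ` in `H` -/
  | h3 (r : HilbertRule L) (hr : r ∈ H) (γ : Fm L) (hγ : γ ∈ r.premises) :
      HilbertCalculus.CompanionRule H star S
        ⟨(r.premises \ {γ}) ∪ {app star γ r.conclusion}, r.conclusion⟩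
  /-- `S ▷ α` -/
  | h4 (α : Fm L) : HilbertCalculus.CompanionRule H star S ⟨S, α⟩
  /-- `χ(δ, z⃗) ▷ χ(ε, z⃗)` -/
  | h5 (δ ε : Fm L) (h : PartitionIdentity star δ ε) (χ : Fm L) (v : ℕ) :
      HilbertCalculus.CompanionRule H star S ⟨{replaceVar χ v δ}, replaceVar χ v ε⟩
  /-- `χ(ε, z⃗) ▷ χ(δ, z⃗)` -/
  | h5_symm (δ ε : Fm L) (h : PartitionIdentity star δ ε) (χ : Fm L) (v : ℕ) :
      HilbertCalculus.CompanionRule H star S ⟨{replaceVar χ v ε}, replaceVar χ v δ⟩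

/-- The calculus `Hʳ`. -/
def HilbertCalculus.companion {L : FirstOrder.Language.{u, v}} (H : HilbertCalculus L)
    (star : L.Term (Fin 2)) (S : Set (Fm L)) : HilbertCalculus L :=
  {r | HilbertCalculus.CompanionRule H star S r}

end ContainmentLogic

/-! Soundness: every rule of `Hʳ` is valid in `⊢ʳ`, and `⊢ʳ` is a logic, so derivations stay inside
it.

Completeness: the key fact is `derives_app_of_varsOf_subset`. If `α` is derivable in `Hʳ` from `Γ`
and `Var(ψ) ⊆ Var(Γ)`, then so is `α ∗ ψ`. By (P5) the right argument of `∗` matters only through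
its variables. By (P2) and (P3) their order is immaterial, and by (H2) they can be dropped, so each
variable can be extracted from a premise in which it occurs. Hence each step of an `H`-derivation is
simulated by (H0) or (H3), provided its conclusion has all its variables in `Var(Γ)`. This is
arranged by first substituting a variable of `φ` for every variable foreign to `Γ`
(`companion_subst`). If `Γ` includes an antitheorem, `H` derives `Σ(y)` from `Γ` for some `y ∈
Var(Γ)`. The previous case transfers this to `Hʳ`, and (H4) finishes. -/

namespace ContainmentLogic

open FirstOrder.Language

/-! ### Substitutions and variable occurrence. -/

section Substitution

variable {L : FirstOrder.Language.{u, v}}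

theorem subst_subst {α β γ : Type*} (s : α → L.Term β) (t : β → L.Term γ) (φ : L.Term α) :
    (φ.subst s).subst t = φ.subst (fun i => (s i).subst t) := by
  induction φ with
  | var m => rfl
  | func f ts ih => simp only [Term.subst, ih]

theorem subst_var {α : Type*} (φ : L.Term α) : φ.subst Term.var = φ := by
  induction φ with
  | var m => rfl
  | func f ts ih => simp only [Term.subst, ih]

theorem subst_congr {s t : ℕ → Fm L} (φ : Fm L) (h : ∀ n ∈ varsOf φ, s n = t n) :
    φ.subst s = φ.subst t := by
  induction φ with
  | var m => exact h m (by simp [varsOf, Term.varFinset])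
  | func f ts ih =>
    simp only [Term.subst]
    congr 1
    funext i
    refine ih i fun n hn => h n ?_
    simp only [varsOf, Term.varFinset, Finset.coe_biUnion, Finset.coe_univ, Set.mem_univ,
      Set.iUnion_true, Set.mem_iUnion] at hn ⊢
    exact ⟨i, hn⟩

theorem substSet_var (Γ : Set (Fm L)) : substSet Term.var Γ = Γ := by
  simp [substSet, subst_var]

theorem mem_varsOf_var {m n : ℕ} : n ∈ varsOf (Term.var m : Fm L) ↔ n = m := by
  simp [varsOf, Term.varFinset]

theorem mem_varsOf_func {k n : ℕ} (f : L.Functions k) (ts : Fin k → Fm L) :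
    n ∈ varsOf (Term.func f ts : Fm L) ↔ ∃ i, n ∈ varsOf (ts i) := by
  simp [varsOf, Term.varFinset]

theorem mem_varsOf_subst_of_term {α : Type*} [DecidableEq α] (t : L.Term α) (s : α → Fm L)
    (n : ℕ) : n ∈ varsOf (t.subst s) ↔ ∃ i ∈ t.varFinset, n ∈ varsOf (s i) := by
  induction t with
  | var m => simp [Term.subst, Term.varFinset]
  | func f ts ih =>
    simp only [Term.subst, mem_varsOf_func, ih, Term.varFinset, Finset.mem_biUnion,
      Finset.mem_univ, true_and]
    constructor
    · rintro ⟨i, m, hm, hn⟩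
      exact ⟨m, ⟨i, hm⟩, hn⟩
    · rintro ⟨m, ⟨i, hm⟩, hn⟩
      exact ⟨i, m, hm, hn⟩

theorem app_subst (star : L.Term (Fin 2)) (α β : Fm L) (s : ℕ → Fm L) :
    (app star α β).subst s = app star (α.subst s) (β.subst s) := by
  unfold app
  rw [subst_subst]
  congr 1
  funext i
  fin_cases i <;> rfl

theorem foldl_app_subst (star : L.Term (Fin 2)) (l : List (Fm L)) (α : Fm L) (s : ℕ → Fm L) :
    (l.foldl (app star) α).subst s
      = (l.map fun β => β.subst s).foldl (app star) (α.subst s) := by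
  induction l generalizing α with
  | nil => rfl
  | cons β l ih => simp only [List.foldl_cons, List.map_cons, ih, app_subst]

theorem mem_varsOf_app {star : L.Term (Fin 2)} (h : ∀ i, i ∈ star.varFinset) (α β : Fm L)
    (n : ℕ) : n ∈ varsOf (app star α β) ↔ n ∈ varsOf α ∨ n ∈ varsOf β := by
  unfold app
  rw [mem_varsOf_subst_of_term]
  simp [h, Fin.exists_fin_two]

theorem mem_varsOf_foldl_app {star : L.Term (Fin 2)} (h : ∀ i, i ∈ star.varFinset)
    (l : List (Fm L)) (α : Fm L) (n : ℕ) :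
    n ∈ varsOf (l.foldl (app star) α) ↔ n ∈ varsOf α ∨ ∃ β ∈ l, n ∈ varsOf β := by
  induction l generalizing α with
  | nil => simp
  | cons β l ih => simp [ih, mem_varsOf_app h, or_assoc]

/-- Makes (H5) respect variable containment; the hypothesis that both variables occur in `star` is
what prevents `∗` from losing an argument. -/
theorem PartitionIdentity.varsOf_eq {star : L.Term (Fin 2)} (h : ∀ i, i ∈ star.varFinset)
    {δ ε : Fm L} (hp : PartitionIdentity star δ ε) : varsOf δ = varsOf ε := by
  ext n
  cases hp with
  | p1 a => simp [mem_varsOf_app h]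
  | p2 a b c => simp [mem_varsOf_app h, or_assoc]
  | p3 a b c => simp only [mem_varsOf_app h]; tauto
  | p4 g a b => simp [mem_varsOf_app h, mem_varsOf_func, exists_or]
  | p5 g a b =>
    simp only [mem_varsOf_app h, mem_varsOf_func, mem_varsOf_foldl_app h, List.mem_ofFn,
      exists_exists_eq_and]

theorem varsOf_replaceVar_subset {δ ε : Fm L} (h : varsOf δ ⊆ varsOf ε) (χ : Fm L) (k : ℕ) :
    varsOf (replaceVar χ k δ) ⊆ varsOf (replaceVar χ k ε) := by
  intro n hn
  obtain ⟨m, hm, hn⟩ := (mem_varsOf_subst _ χ n).1 hn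
  refine (mem_varsOf_subst _ χ n).2 ⟨m, hm, ?_⟩
  by_cases hmk : m = k
  · subst hmk
    rw [Function.update_self] at hn ⊢
    exact h hn
  · rwa [Function.update_of_ne hmk] at hn ⊢

end Substitution

/-! ### Soundness of `Hʳ` for the containment companion. -/

section Soundness

variable {L : FirstOrder.Language.{u, v}} {l : Logic L} {star : L.Term (Fin 2)}

theorem HilbertCalculus.IsCompleteFor.entails_of_mem {H : HilbertCalculus L}
    (hH : H.IsCompleteFor l) {r : HilbertRule L} (hr : r ∈ H) :
    l.Entails r.premises r.conclusion := by
  rw [← hH]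
  have := HilbertCalculus.Derives.rule (Γ := r.premises) hr Term.var
    fun γ hγ => by rw [subst_var]; exact .hyp hγ
  rwa [subst_var] at this

theorem Logic.IsRPartitionFunction.app_entails_left (hstar : l.IsRPartitionFunction star)
    (α β : Fm L) : l.Entails {app star α β} α := by
  have := l.structural (fun n => if n = 0 then α else β) (hstar.app_entails 0 1)
  simpa [substSet, app_subst, Term.subst] using this

/-- In (H0) and (H3) the conclusion is itself an argument of `∗` in a premise, which gives
containment of variables. In (H3) the missing premise is recovered from the left argument. -/
theorem HilbertCalculus.CompanionRule.containmentEntails (hstar : l.IsRPartitionFunction star)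
    {S : Set (Fm L)} (hne : S.Nonempty) (hS : l.IsAntitheorem S) {H : HilbertCalculus L}
    (hH : H.IsCompleteFor l) {r : HilbertRule L} (hr : H.CompanionRule star S r) :
    l.ContainmentEntails r.premises r.conclusion := by
  have occ := hstar.occur
  cases hr with
  | h0 φ hφ x =>
    refine .inl ⟨l.mono (Set.empty_subset _) (hH.entails_of_mem hφ), fun n hn => ?_⟩
    simp [varsOfSet, mem_varsOf_app occ, hn]
  | h1 x y =>
    refine .inl ⟨hstar.entails_app x y, fun n hn => ?_⟩
    simpa [varsOfSet, mem_varsOf_app occ] using hn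
  | h2 x y =>
    refine .inl ⟨hstar.app_entails x y, fun n hn => ?_⟩
    simp [varsOfSet, mem_varsOf_app occ, hn]
  | h3 r hr' γ hγ =>
    refine .inl ⟨l.cut (fun δ (hδ : δ ∈ r.premises) => ?_) (hH.entails_of_mem hr'), fun n hn => ?_⟩
    · by_cases h : δ = γ
      · subst h
        exact l.mono Set.subset_union_right (hstar.app_entails_left δ r.conclusion)
      · exact l.refl (.inl ⟨hδ, h⟩)
    · exact (mem_varsOfSet _ n).2 ⟨_, .inr rfl, (mem_varsOf_app occ _ _ n).2 (.inr hn)⟩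
  | h4 α => exact .inr ⟨S, hne, hS, subset_rfl⟩
  | h5 δ ε h χ k =>
    refine .inl ⟨(hstar.interderivable δ ε h χ k).2, ?_⟩
    simpa [varsOfSet] using varsOf_replaceVar_subset (h.varsOf_eq occ).ge χ k
  | h5_symm δ ε h χ k =>
    refine .inl ⟨(hstar.interderivable δ ε h χ k).1, ?_⟩
    simpa [varsOfSet] using varsOf_replaceVar_subset (h.varsOf_eq occ).le χ k

theorem HilbertCalculus.Derives.entails {l : Logic L} {H : HilbertCalculus L}
    (hH : ∀ r ∈ H, l.Entails r.premises r.conclusion) {Γ : Set (Fm L)} {φ : Fm L}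
    (h : H.Derives Γ φ) : l.Entails Γ φ := by
  induction h with
  | hyp h => exact l.refl h
  | rule hr s _ ih =>
    refine l.cut ?_ (l.structural s (hH _ hr))
    rintro _ ⟨γ, hγ, rfl⟩
    exact ih γ hγ

end Soundness

/-! ### Completeness: simulating `H` inside `Hʳ`. -/

section Completeness

variable {L : FirstOrder.Language.{u, v}} {star : L.Term (Fin 2)} {H : HilbertCalculus L}
  {S Γ : Set (Fm L)}

theorem derives_app {α β : Fm L} (hα : (H.companion star S).Derives Γ α)
    (hβ : (H.companion star S).Derives Γ β) :
    (H.companion star S).Derives Γ (app star α β) := by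
  have := HilbertCalculus.Derives.rule (H := H.companion star S) (Γ := Γ)
    (HilbertCalculus.CompanionRule.h1 0 1) (fun n => if n = 0 then α else β)
    (by simp [Term.subst, hα, hβ])
  simpa [app_subst, Term.subst] using this

theorem derives_left_of_app {α β : Fm L}
    (h : (H.companion star S).Derives Γ (app star α β)) :
    (H.companion star S).Derives Γ α := by
  have := HilbertCalculus.Derives.rule (H := H.companion star S) (Γ := Γ)
    (HilbertCalculus.CompanionRule.h2 0 1) (fun n => if n = 0 then α else β)
    (by simpa [app_subst, Term.subst] using h)
  simpa [Term.subst] using this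

/-- The trivial context `χ = v` is enough: partition identities are only needed at the root of a
formula. -/
theorem PartitionIdentity.derives_iff {δ ε : Fm L} (h : PartitionIdentity star δ ε)
    (s : ℕ → Fm L) : (H.companion star S).Derives Γ (δ.subst s) ↔
      (H.companion star S).Derives Γ (ε.subst s) := by
  constructor <;> intro hd
  · have := HilbertCalculus.Derives.rule (H := H.companion star S) (Γ := Γ)
      (HilbertCalculus.CompanionRule.h5 δ ε h (.var 0) 0) s
      (by simpa [replaceVar, Term.subst] using hd)
    simpa [replaceVar, Term.subst] using this
  · have := HilbertCalculus.Derives.rule (H := H.companion star S) (Γ := Γ)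
      (HilbertCalculus.CompanionRule.h5_symm δ ε h (.var 0) 0) s
      (by simpa [replaceVar, Term.subst] using hd)
    simpa [replaceVar, Term.subst] using this

theorem derives_app_assoc (α β γ : Fm L) :
    (H.companion star S).Derives Γ (app star α (app star β γ)) ↔
      (H.companion star S).Derives Γ (app star (app star α β) γ) := by
  have := (PartitionIdentity.p2 (star := star) 0 1 2).derives_iff (H := H) (S := S) (Γ := Γ)
    (fun n => if n = 0 then α else if n = 1 then β else γ)
  simpa [app_subst, Term.subst] using this

theorem derives_app_app_comm {α β γ : Fm L}
    (h : (H.companion star S).Derives Γ (app star (app star α β) γ)) :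
    (H.companion star S).Derives Γ (app star (app star α γ) β) := by
  have := (PartitionIdentity.p3 (star := star) 0 1 2).derives_iff (H := H) (S := S) (Γ := Γ)
    (fun n => if n = 0 then α else if n = 1 then β else γ)
  simp only [app_subst, Term.subst] at this
  exact (derives_app_assoc α γ β).1 (this.1 ((derives_app_assoc α β γ).2 h))

theorem derives_app_func {n : ℕ} (g : L.Functions (n + 1)) (ts : Fin (n + 1) → Fm L)
    (α : Fm L) : (H.companion star S).Derives Γ (app star α (.func g ts)) ↔
      (H.companion star S).Derives Γ ((List.ofFn ts).foldl (app star) α) := by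
  -- Variable 0 carries `α` and variable `i + 1` carries the `i`-th argument; the value beyond the
  -- arity is never used.
  obtain ⟨s, hs0, hs⟩ : ∃ s : ℕ → Fm L, s 0 = α ∧ ∀ i : Fin (n + 1), s (i + 1) = ts i :=
    ⟨fun k => if k = 0 then α else if h : k - 1 < n + 1 then ts ⟨k - 1, h⟩ else α,
      rfl, fun i => by simp only [Nat.add_sub_cancel, i.isLt, dif_pos]; simp⟩
  have := (PartitionIdentity.p5 (star := star) g (fun i => (i : ℕ) + 1) 0).derives_iff
    (H := H) (S := S) (Γ := Γ) s
  rw [app_subst, foldl_app_subst, List.map_ofFn] at this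
  simpa only [Function.comp_def, Term.subst, hs0, hs] using this

theorem derives_of_foldl_app {α : Fm L} (l : List (Fm L))
    (h : (H.companion star S).Derives Γ (l.foldl (app star) α)) :
    (H.companion star S).Derives Γ α := by
  induction l generalizing α with
  | nil => exact h
  | cons β l ih => exact derives_left_of_app (ih h)

/-- Factors after `β` are stripped by (H2); a factor before `β` is swapped past it and then
stripped. -/
theorem derives_app_of_foldl_app {α β : Fm L} (l : List (Fm L)) (hβ : β ∈ l)
    (h : (H.companion star S).Derives Γ (l.foldl (app star) α)) :
    (H.companion star S).Derives Γ (app star α β) := by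
  induction l generalizing α with
  | nil => simp at hβ
  | cons γ l ih =>
    rcases List.mem_cons.1 hβ with rfl | hβ
    · exact derives_of_foldl_app l h
    · exact derives_left_of_app (derives_app_app_comm (ih hβ h))

variable [IsEmpty L.Constants]

theorem derives_app_var_of_app {α γ : Fm L} {y : ℕ} (hy : y ∈ varsOf γ)
    (h : (H.companion star S).Derives Γ (app star α γ)) :
    (H.companion star S).Derives Γ (app star α (.var y)) := by
  induction γ with
  | var m => rwa [mem_varsOf_var.1 hy]
  | @func n g ts ih =>
    cases n with
    | zero => exact isEmptyElim (α := L.Constants) g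
    | succ n =>
      obtain ⟨i, hi⟩ := (mem_varsOf_func g ts).1 hy
      exact ih i hi (derives_app_of_foldl_app _ (List.mem_ofFn.2 ⟨i, rfl⟩)
        ((derives_app_func g ts α).1 h))

/-- A variable of `ψ` occurs in some `γ ∈ Γ`; (H1) gives `α ∗ γ`, from which the variable is
extracted. For compound `ψ`, (P5) reduces to appending the arguments one at a time, so `α` must vary
in the induction. -/
theorem derives_app_of_varsOf_subset {α ψ : Fm L} (hψ : varsOf ψ ⊆ varsOfSet Γ)
    (h : (H.companion star S).Derives Γ α) :
    (H.companion star S).Derives Γ (app star α ψ) := by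
  induction ψ generalizing α with
  | var m =>
    obtain ⟨γ, hγ, hm⟩ := (mem_varsOfSet Γ m).1 (hψ (mem_varsOf_var.2 rfl))
    exact derives_app_var_of_app hm (derives_app h (.hyp hγ))
  | @func n g ts ih =>
    cases n with
    | zero => exact isEmptyElim (α := L.Constants) g
    | succ n =>
      rw [derives_app_func]
      -- Stated for any list of arguments of `g`, so that induction on the list can proceed.
      have key : ∀ (l : List (Fm L)), (∀ β ∈ l, β ∈ List.ofFn ts) → ∀ {α : Fm L},
          (H.companion star S).Derives Γ α →
          (H.companion star S).Derives Γ (l.foldl (app star) α) := by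
        intro l
        induction l with
        | nil => exact fun _ _ h => h
        | cons β l ihl =>
          intro hl α hα
          obtain ⟨i, rfl⟩ := List.mem_ofFn.1 (hl β (by simp))
          exact ihl (fun γ hγ => hl γ (by simp [hγ]))
            (ih i (fun n hn => hψ ((mem_varsOf_func g ts).2 ⟨i, hn⟩)) hα)
      exact key _ (fun _ h => h) h

/-- Variables outside the premises can be renamed, by `s`, into variables of the premises. -/
theorem HilbertCalculus.Derives.companion_subst {s : ℕ → Fm L} (hne : Γ.Nonempty)
    (hs : ∀ n ∈ varsOfSet Γ, s n = .var n) (hs' : ∀ n, varsOf (s n) ⊆ varsOfSet Γ)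
    {φ : Fm L} (h : H.Derives Γ φ) : (H.companion star S).Derives Γ (φ.subst s) := by
  have hvars : ∀ ψ : Fm L, varsOf (ψ.subst s) ⊆ varsOfSet Γ := fun ψ n hn => by
    obtain ⟨m, -, hn⟩ := (mem_varsOf_subst s ψ n).1 hn
    exact hs' m hn
  induction h with
  | @hyp φ h =>
    rw [subst_congr φ (t := Term.var) fun n hn => hs n ((mem_varsOfSet Γ n).2 ⟨φ, h, hn⟩),
      subst_var]
    exact .hyp h
  | @rule r hr t _ ih =>
    have hψ := hvars (r.conclusion.subst t)
    rw [subst_subst] at hψ ⊢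
    simp only [subst_subst] at ih
    rcases r.premises.eq_empty_or_nonempty with hr0 | ⟨γ, hγ⟩
    · obtain ⟨δ, hδ⟩ := hne
      -- As `y` is absent from the axiom, sending `y` to the premise `δ` leaves the axiom's instance
      -- unchanged, and (H0) then asks only for `δ ∗ ψ`.
      obtain ⟨y, hy⟩ := Infinite.exists_notMem_finset r.conclusion.varFinset
      have hax : (⟨∅, r.conclusion⟩ : HilbertRule L) ∈ H := by rwa [← hr0]
      have heq : r.conclusion.subst (Function.update (fun i => (t i).subst s) y δ)
          = r.conclusion.subst (fun i => (t i).subst s) :=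
        subst_congr _ fun n hn => Function.update_of_ne (by rintro rfl; exact hy hn) _ _
      rw [← heq] at hψ ⊢
      refine HilbertCalculus.Derives.rule (H := H.companion star S) (Γ := Γ)
        (HilbertCalculus.CompanionRule.h0 r.conclusion hax y) _ ?_
      rintro _ rfl
      rw [app_subst]
      refine derives_app_of_varsOf_subset hψ ?_
      simpa [Term.subst] using HilbertCalculus.Derives.hyp hδ
    -- Any premise `γ` of the rule may serve as the one weighted by the conclusion.
    · refine HilbertCalculus.Derives.rule (H := H.companion star S) (Γ := Γ)
        (HilbertCalculus.CompanionRule.h3 r hr γ hγ) _ ?_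
      rintro δ (⟨hδ, -⟩ | rfl)
      · exact ih δ hδ
      · rw [app_subst]
        exact derives_app_of_varsOf_subset hψ (ih γ hγ)

theorem HilbertCalculus.Derives.companion {φ : Fm L} (hφ : varsOf φ ⊆ varsOfSet Γ)
    (h : H.Derives Γ φ) : (H.companion star S).Derives Γ φ := by
  classical
  obtain ⟨y, hy⟩ := varsOf_nonempty φ
  obtain ⟨γ, hγ, -⟩ := (mem_varsOfSet Γ y).1 (hφ hy)
  have := h.companion_subst (star := star) (S := S)
    -- This renaming fixes `Γ` and also `φ`, whose variables all lie in `Γ`.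
    (s := fun n => if n ∈ varsOfSet Γ then .var n else .var y) ⟨γ, hγ⟩
    (fun n hn => if_pos hn) (fun n => by
      split_ifs with hn
      · rintro m hm; rwa [mem_varsOf_var.1 hm]
      · rintro m hm; rw [mem_varsOf_var.1 hm]; exact hφ hy)
  rwa [subst_congr φ (t := Term.var) fun n hn => if_pos (hφ hn), subst_var] at this

/-- `H` derives every formula from `Γ`, in particular those of `Σ(y)`, whose only variable `y`
occurs in `Γ`; hence `Hʳ` derives them too. -/
theorem derives_companion_of_antitheorem {x y : ℕ} (hSx : varsOfSet S = {x})
    (hy : y ∈ varsOfSet Γ) (h : ∀ φ, H.Derives Γ φ) (φ : Fm L) :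
    (H.companion star S).Derives Γ φ := by
  have := HilbertCalculus.Derives.rule (H := H.companion star S) (Γ := Γ)
    -- The conclusion is a variable other than `x`, so one substitution can send it to `φ` while
    -- turning `Σ(x)` into `Σ(y)`.
    (HilbertCalculus.CompanionRule.h4 (.var (x + 1)))
    (Function.update (fun _ => .var y) (x + 1) φ) (fun γ hγ => by
      refine (h _).companion fun n hn => ?_
      obtain ⟨m, hm, hn⟩ := (mem_varsOf_subst _ γ n).1 hn
      have hmx : m = x := by
        have : m ∈ varsOfSet S := (mem_varsOfSet S m).2 ⟨γ, hγ, hm⟩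
        rwa [hSx] at this
      rw [Function.update_of_ne (by omega), mem_varsOf_var] at hn
      rwa [hn])
  simpa [Term.subst] using this

end Completeness

end ContainmentLogic

theorem mainTheorem2 {L : FirstOrder.Language.{u, v}} [IsEmpty L.Constants]
    (l : ContainmentLogic.Logic L) (hfin : l.Finitary)
    (star : L.Term (Fin 2)) (hstar : l.IsRPartitionFunction star)
    (x : ℕ) (S : Set (ContainmentLogic.Fm L)) (hSx : ContainmentLogic.varsOfSet S = {x})
    (hS : l.IsAntitheorem S)
    (H : ContainmentLogic.HilbertCalculus L) (hHfin : H.HasFiniteRules)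
    (hH : H.IsCompleteFor l) :
    (ContainmentLogic.HilbertCalculus.companion H star S).IsCompleteFor l.containment := by
  intro Γ φ
  constructor
  · have hx : x ∈ ContainmentLogic.varsOfSet S := by simp [hSx]
    obtain ⟨γ, hγ, -⟩ := (ContainmentLogic.mem_varsOfSet S x).1 hx
    exact fun h => h.entails (l := l.containment) fun r hr =>
      ContainmentLogic.HilbertCalculus.CompanionRule.containmentEntails hstar ⟨γ, hγ⟩ hS hH hr
  · rintro (⟨h, hφ⟩ | ⟨T, ⟨a, ha⟩, hT, hTΓ⟩)
    · exact ((hH Γ φ).2 h).companion hφ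
    · obtain ⟨y, hy⟩ := ContainmentLogic.varsOf_nonempty a
      refine ContainmentLogic.derives_companion_of_antitheorem hSx
        ((ContainmentLogic.mem_varsOfSet Γ y).2 ⟨a, hTΓ ha, hy⟩) (fun ψ => ?_) φ
      rw [hH]
      -- The identity substitution shows that `T`, hence `Γ`, entails every formula.
      have := hT FirstOrder.Language.Term.var ψ
      rw [ContainmentLogic.substSet_var] at this
      exact l.mono hTΓ this
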